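/- Let $n\ge 0$, and let $\mathbb{RP}^n$ and $\mathbb{CP}^n$ carry their usual topologies. A set $E\subset\mathbb{RP}^n$ is called convex if it contains no projective line and meets every projective line in a connected (possibly empty) set; a convex set is called properly convex if moreover it is not contained in a projective hyperplane and contains no affine line, that is, no projective line with one point removed. The elliptic tube with base $D\subset\mathbb{RP}^n$ is $$D^e=\bigcup\{I^e : I\subset D \text{ a closed segment}\}\subset\mathbb{CP}^n ,$$ where for $I=\{[c_0v_0+c_1v_1] : c_0,c_1\in\mathbb{R},\ c_0c_1\ge 0,\ c_0v_0+c_1v_1\ne 0\}$ with $v_0,v_1\in\mathbb{R}^{n+1}\setminus\{0\}$ (a single point being allowed as a segment) $$I^e=\{[c_0v_0+c_1v_1] : c_0,c_1\in\mathbb{C},\ \operatorname{Re}(c_0\overline{c_1})\ge 0,\ c_0v_0+c_1v_1\ne 0\}.$$ A set $E\subset\mathbb{CP}^n$ is called $\mathbb{C}$-convex if it contains no complex projective line and each of its nonempty intersections with complex projective lines is connected and simply connected. **Theorem.** Suppose that $D\subset\mathbb{RP}^n$ is a properly convex open set whose boundary $\partial D$ is of class $C^1$ (in affine charts, $\partial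 D$ is near each of its points the zero set of a real-valued $C^1$ function with nowhere vanishing differential). Then $D^e$ is $\mathbb{C}$-convex. -/

import Mathlib

open scoped LinearAlgebra.Projectivization

/-- The quotient topology on the projective space of a topological vector space. -/
instance Projectivization.instQuotientTopology (K V : Type*) [DivisionRing K] [AddCommGroup V]
    [Module K V] [TopologicalSpace V] : TopologicalSpace (ℙ K V) :=
  inferInstanceAs (TopologicalSpace (Quotient (projectivizationSetoid K V)))

namespace EllipticTube

section Projective

variable {K V : Type*} [Field K] [AddCommGroup V] [Module K V]

/-- A projective line: the set of points of a two-dimensional linear subspace. -/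
def IsProjLine (L : Set (ℙ K V)) : Prop :=
  ∃ M : Submodule K V, Module.finrank K M = 2 ∧ L = (M.projectivization : Set (ℙ K V))

/-- A projective hyperplane: the set of zeros of a nonzero linear functional. -/
def IsProjHyperplane (H : Set (ℙ K V)) : Prop :=
  ∃ ξ : Module.Dual K V, ξ ≠ 0 ∧ H = ((LinearMap.ker ξ).projectivization : Set (ℙ K V))

/-- An affine line: a projective line with one of its points removed. -/
def IsAffineLine (A : Set (ℙ K V)) : Prop :=
  ∃ L : Set (ℙ K V), IsProjLine L ∧ ∃ p ∈ L, A = L \ {p}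

end Projective

section Convexity

variable {V : Type*} [AddCommGroup V] [TopologicalSpace V]

/-- Convex subsets of a real projective space: they contain no projective line, and they meet every
projective line in a connected set (the empty intersection is allowed). -/
def IsProjConvex [Module ℝ V] (E : Set (ℙ ℝ V)) : Prop :=
  ∀ L : Set (ℙ ℝ V), IsProjLine L → ¬ L ⊆ E ∧ IsPreconnected (E ∩ L)

/-- Properly convex subsets of a real projective space: convex, not contained in a projective
hyperplane, and containing no affine line. -/
def IsProperlyConvex [Module ℝ V] (E : Set (ℙ ℝ V)) : Prop :=
  IsProjConvex E ∧
    (∀ H : Set (ℙ ℝ V), IsProjHyperplane H → ¬ E ⊆ H) ∧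
    (∀ A : Set (ℙ ℝ V), IsAffineLine A → ¬ A ⊆ E)

/-- `ℂ`-convex subsets of a complex projective space: they contain no projective line, and every
nonempty intersection with a projective line is connected and simply connected. -/
def IsCConvex [Module ℂ V] (E : Set (ℙ ℂ V)) : Prop :=
  ∀ L : Set (ℙ ℂ V), IsProjLine L →
    ¬ L ⊆ E ∧ ((E ∩ L).Nonempty → IsConnected (E ∩ L) ∧ IsSimplyConnected (E ∩ L))

end Convexity

section Tube

variable {n : ℕ}

/-- The closed segment `π({c₀ v₀ + c₁ v₁ | c₀ c₁ ≥ 0})` of `ℝℙⁿ` with endpoints `π(v₀)`, `π(v₁)`. -/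
def closedSegment (v₀ v₁ : Fin (n + 1) → ℝ) : Set (ℙ ℝ (Fin (n + 1) → ℝ)) :=
  {x | ∃ (c₀ c₁ : ℝ) (h : c₀ • v₀ + c₁ • v₁ ≠ 0), 0 ≤ c₀ * c₁ ∧ x = Projectivization.mk ℝ _ h}

/-- A real vector seen as a complex vector. -/
def complexify (v : Fin (n + 1) → ℝ) : Fin (n + 1) → ℂ := fun i => (v i : ℂ)

/-- The closed disc `π({c₀ v₀ + c₁ v₁ | Re (c₀ c̄₁) ≥ 0})`, in the complexification of the real line
through `π(v₀)` and `π(v₁)`, whose diameter is the closed segment given by `v₀` and `v₁`. -/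
def segmentTube (v₀ v₁ : Fin (n + 1) → ℝ) : Set (ℙ ℂ (Fin (n + 1) → ℂ)) :=
  {z | ∃ (c₀ c₁ : ℂ) (h : c₀ • complexify v₀ + c₁ • complexify v₁ ≠ 0),
    0 ≤ (c₀ * (starRingEnd ℂ) c₁).re ∧ z = Projectivization.mk ℂ _ h}

/-- The elliptic tube with base `D`: the union of the discs `Iᵉ` over all closed segments `I ⊆ D`
(a single point counts as a segment). -/
def ellipticTube (D : Set (ℙ ℝ (Fin (n + 1) → ℝ))) : Set (ℙ ℂ (Fin (n + 1) → ℂ)) :=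
  {z | ∃ v₀ v₁ : Fin (n + 1) → ℝ, v₀ ≠ 0 ∧ v₁ ≠ 0 ∧ closedSegment v₀ v₁ ⊆ D ∧
    z ∈ segmentTube v₀ v₁}

end Tube

section Boundary

variable {n : ℕ}

lemma insertNth_one_ne_zero (i : Fin (n + 1)) (y : Fin n → ℝ) :
    (Fin.insertNth i (1 : ℝ) y : Fin (n + 1) → ℝ) ≠ 0 := by
  intro h
  have h1 := congrFun h i
  simp at h1

/-- The `i`-th standard affine parametrisation `ℝⁿ → ℝℙⁿ`,
`y ↦ [y₁ : … : yᵢ : 1 : yᵢ₊₁ : … : yₙ]`. -/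
noncomputable def affineParam (i : Fin (n + 1)) (y : Fin n → ℝ) : ℙ ℝ (Fin (n + 1) → ℝ) :=
  Projectivization.mk ℝ (Fin.insertNth i (1 : ℝ) y) (insertNth_one_ne_zero i y)

/-- The boundary of `D` is of class `C¹`: read in the standard affine charts, it is near each of its
points the zero set of a `C¹` function with nowhere vanishing differential. -/
def HasC1Boundary (D : Set (ℙ ℝ (Fin (n + 1) → ℝ))) : Prop :=
  ∀ (i : Fin (n + 1)) (y : Fin n → ℝ), affineParam i y ∈ frontier D →
    ∃ (U : Set (Fin n → ℝ)) (f : (Fin n → ℝ) → ℝ), IsOpen U ∧ y ∈ U ∧ ContDiffOn ℝ 1 f U ∧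
      (∀ x ∈ U, fderiv ℝ f x ≠ 0) ∧ ∀ x ∈ U, affineParam i x ∈ frontier D ↔ f x = 0

end Boundary

end EllipticTube

/-! The vectors over an open convex set `D` form two opposite open convex cones `C` and `-C`
(`exists_convex_cone`). Multiplying by a suitable complex number moves any point of `D^e` to a
vector `x + iy` with `x, y ∈ C`, and all such vectors arise (`mem_ellipticTube_iff`). So `D^e` is
the image of the open convex set `complexCone C`.

A functional negative on `C` extends to a complex functional without zeros on this set, and its
kernel meets every complex line, so `D^e` contains no line. On a complex line, the image of the
convex slice has a continuous section: the admissible scalars for a given vector form a convex set,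
so local constant choices can be glued. The intersection is thus a retract of a convex set, hence
contractible (`isCConvex_of_complexCone`). -/

namespace EllipticTube

open Set Topology Filter

/-! ### Cones over subsets of projective space. -/

section Cone

variable {K V : Type*} [Field K] [AddCommGroup V] [Module K V]

/-- The set of nonzero vectors whose class lies in `D`. -/
def coneOver (D : Set (ℙ K V)) : Set V := {v | ∃ h : v ≠ 0, Projectivization.mk K v h ∈ D}

lemma smul_mem_coneOver {D : Set (ℙ K V)} {c : K} (hc : c ≠ 0) {v : V} (hv : v ∈ coneOver D) :
    c • v ∈ coneOver D := by
  obtain ⟨h, hD⟩ := hv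
  refine ⟨smul_ne_zero hc h, ?_⟩
  rwa [(Projectivization.mk_eq_mk_iff' K (c • v) v (smul_ne_zero hc h) h).2 ⟨c, rfl⟩]

lemma isOpen_mk_of_isOpen_coneOver [TopologicalSpace V] {D : Set (ℙ K V)}
    (hD : IsOpen (coneOver D)) : IsOpen D := by
  have h : IsOpen ((Projectivization.mk' K : {v : V // v ≠ 0} → ℙ K V) ⁻¹' D) := by
    convert hD.preimage continuous_subtype_val using 1
    ext v
    exact ⟨fun h => ⟨v.2, h⟩, fun ⟨_, h⟩ => h⟩
  exact h

lemma isOpen_coneOver [TopologicalSpace V] [T1Space V] {D : Set (ℙ K V)} (hD : IsOpen D) :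
    IsOpen (coneOver D) := by
  have h : IsOpen ((Projectivization.mk' K : {v : V // v ≠ 0} → ℙ K V) ⁻¹' D) := hD
  have h0 : IsOpen {v : V | v ≠ 0} := isOpen_ne
  convert h0.isOpenMap_subtype_val _ h using 1
  ext v
  constructor
  · rintro ⟨h, hv⟩
    exact ⟨⟨v, h⟩, hv, rfl⟩
  · rintro ⟨v, hv, rfl⟩
    exact ⟨v.2, hv⟩

lemma isProjLine_span_pair {a b : V} (hab : LinearIndependent K ![a, b]) :
    IsProjLine ((Submodule.span K {a, b}).projectivization : Set (ℙ K V)) := by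
  refine ⟨_, ?_, rfl⟩
  have h := finrank_span_eq_card hab
  rw [Matrix.range_cons_cons_empty] at h
  simpa using h

end Cone

/-! ### The two convex halves of the cone over an open convex set. -/

section RealCone

/-- Tube lemma over the compact parameter interval. It gives both the openness of `C` and the open
sets of the connectedness argument. -/
lemma isOpen_setOf_segment_subset {V : Type*} [NormedAddCommGroup V] [NormedSpace ℝ V]
    {W : Set V} (hW : IsOpen W) (c : V) :
    IsOpen {x | segment ℝ c x ⊆ W} := by
  rw [isOpen_iff_mem_nhds]
  intro x hx
  have := (isCompact_Icc (a := (0 : ℝ)) (b := 1)).eventually_forall_of_forall_eventually (x₀ := x)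
    (P := fun y θ => c + θ • (y - c) ∈ W) (fun θ hθ => by
      have hc : Continuous fun z : V × ℝ => c + z.2 • (z.1 - c) := by fun_prop
      exact hc.continuousAt.preimage_mem_nhds (hW.mem_nhds (hx (by
        rw [segment_eq_image']; exact ⟨θ, hθ, rfl⟩))))
  filter_upwards [this] with y hy
  simp only [segment_eq_image']
  rintro _ ⟨θ, hθ, rfl⟩
  exact hy θ hθ

variable {V : Type*} [NormedAddCommGroup V] [NormedSpace ℝ V] [FiniteDimensional ℝ V]

/-- A segment over a convex set `D` whose line contains, off the segment, a point outside of `D`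
lies over `D` if its endpoints do. -/
lemma segment_subset_coneOver {D : Set (ℙ ℝ V)} (hconv : IsProjConvex D) {a b : V}
    (ha : a ∈ coneOver D) (hb : b ∈ coneOver D) (hab : LinearIndependent ℝ ![a, b]) {α β : ℝ}
    (hαβ : α * β < 0) (hu : α • a + β • b ∉ coneOver D) : segment ℝ a b ⊆ coneOver D := by
  -- `g` extends the coordinates on the span of `a`, `b` to all of `V`.
  obtain ⟨g, hg⟩ := LinearMap.exists_leftInverse_of_injective
    (Fintype.linearCombination ℝ ![a, b]) (LinearMap.ker_eq_bot.2
      (linearIndependent_iff_injective_fintypeLinearCombination.1 hab))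
  have hgv : ∀ x y : ℝ, g (x • a + y • b) = ![x, y] := fun x y => by
    have := LinearMap.congr_fun hg ![x, y]
    simpa [Fintype.linearCombination_apply] using this
  have hga : g a = ![1, 0] := by simpa using hgv 1 0
  have hgb : g b = ![0, 1] := by simpa using hgv 0 1
  rintro p ⟨r, s, hr, hs, hrs, rfl⟩
  by_contra hp
  have hr0 : 0 < r := hr.lt_of_ne (by rintro rfl; simp_all)
  have hs0 : 0 < s := hs.lt_of_ne (by rintro rfl; simp_all)
  -- A product of two linear forms vanishing at the missing points `r • a + s • b` and `α • a + β •
  -- b`. Being quadratic, it has a well-defined sign on projective points; its signs at `a` and `b`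
  -- are opposite, so it disconnects `D ∩ L`.
  set q : V → ℝ := fun v => (r * g v 1 - s * g v 0) * (α * g v 1 - β * g v 0) with hq
  have hqc : Continuous q := by
    have : Continuous g := g.continuous_of_finiteDimensional
    fun_prop
  have hqs : ∀ (c : ℝ) v, q (c • v) = c ^ 2 * q v := fun c v => by
    simp only [hq, map_smul, Pi.smul_apply, smul_eq_mul]; ring
  have hcone : ∀ P : ℝ → Prop, (∀ c : ℝ, c ≠ 0 → ∀ x, P x → P (c ^ 2 * x)) →
      ∀ v (hv : v ≠ 0), (Projectivization.mk ℝ v hv ∈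
        {x : ℙ ℝ V | P (q x.rep)} ↔ P (q v)) := by
    intro P hP v hv
    obtain ⟨c, hc⟩ := Projectivization.exists_smul_eq_mk_rep ℝ v hv
    simp only [mem_ofPred_eq, ← hc]
    rw [Units.smul_def, hqs]
    refine ⟨fun h => ?_, hP _ c.ne_zero _⟩
    have := hP (c⁻¹ : ℝ) (inv_ne_zero c.ne_zero) _ h
    rwa [← mul_assoc, ← mul_pow, inv_mul_cancel₀ c.ne_zero, one_pow, one_mul] at this
  have hpos := hcone (· ∈ Ioi 0) (fun c hc x hx => mul_pos (by positivity) hx)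
  have hneg := hcone (· ∈ Iio 0) (fun c hc x hx => mul_neg_of_pos_of_neg (by positivity) hx)
  have hopen : ∀ P : Set ℝ, IsOpen P → (0 : ℝ) ∉ P →
      (∀ v (hv : v ≠ 0), (Projectivization.mk ℝ v hv ∈
        {x : ℙ ℝ V | q x.rep ∈ P} ↔ q v ∈ P)) → IsOpen {x : ℙ ℝ V | q x.rep ∈ P} := by
    intro P hP h0 hm
    apply isOpen_mk_of_isOpen_coneOver
    convert hP.preimage hqc using 1
    ext v
    refine ⟨fun ⟨h, hv⟩ => (hm v h).1 hv, fun hv => ?_⟩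
    have hv0 : v ≠ 0 := by
      rintro rfl
      exact h0 (by simpa [hq] using hv)
    exact ⟨hv0, (hm v hv0).2 hv⟩
  set L : Set (ℙ ℝ V) := ((Submodule.span ℝ {a, b}).projectivization : Set (ℙ ℝ V)) with hL
  have hLline : IsProjLine L := isProjLine_span_pair hab
  obtain ⟨ha0, haD⟩ := ha
  obtain ⟨hb0, hbD⟩ := hb
  have hqa : q a = s * β := by simp [hq, hga]
  have hqb : q b = r * α := by simp [hq, hgb]
  have hcover : D ∩ L ⊆ {x : ℙ ℝ V | q x.rep ∈ Ioi 0} ∪ {x : ℙ ℝ V | q x.rep ∈ Iio 0} := by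
    rintro x ⟨hxD, hxL⟩
    induction x using Projectivization.ind with | _ v hv =>
    have hvM := (Submodule.mk_mem_projectivization_iff _ hv).1 hxL
    obtain ⟨x, y, rfl⟩ := Submodule.mem_span_pair.1 hvM
    rw [mem_union, hpos _ hv, hneg _ hv, mem_Ioi, mem_Iio, or_comm, ← ne_iff_lt_or_gt]
    intro h0
    simp only [hq, hgv, Matrix.cons_val_zero, Matrix.cons_val_one, mul_eq_zero] at h0
    have hne : x ≠ 0 ∨ y ≠ 0 := by
      by_contra! h
      exact hv (by simp [h.1, h.2])
    have hα : α ≠ 0 := left_ne_zero_of_mul hαβ.ne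
    have hβ : β ≠ 0 := right_ne_zero_of_mul hαβ.ne
    have key : ∀ m k : ℝ, m ≠ 0 → m * y - k * x = 0 → m • a + k • b ∈ coneOver D := by
      intro m k hm hmk
      have hx : x ≠ 0 := by
        rintro rfl
        have : y = 0 := by simpa [hm] using hmk
        simp_all
      have hy : k = m * y / x := by field_simp; linarith
      have : m • a + k • b = (m / x) • (x • a + y • b) := by
        rw [smul_add, smul_smul, smul_smul, hy]
        congr 2 <;> field_simp
      rw [this]
      exact smul_mem_coneOver (div_ne_zero hm hx) ⟨hv, hxD⟩
    rcases h0 with h0 | h0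
    · exact hp (key r s hr0.ne' h0)
    · exact hu (key α β hα h0)
  have hamem : Projectivization.mk ℝ a ha0 ∈ D ∩ L :=
    ⟨haD, (Submodule.mk_mem_projectivization_iff _ ha0).2 (Submodule.subset_span (by simp))⟩
  have hbmem : Projectivization.mk ℝ b hb0 ∈ D ∩ L :=
    ⟨hbD, (Submodule.mk_mem_projectivization_iff _ hb0).2 (Submodule.subset_span (by simp))⟩
  have hsep := (hconv L hLline).2 _ _ (hopen (Ioi 0) isOpen_Ioi (by simp) hpos)
    (hopen (Iio 0) isOpen_Iio (by simp) hneg) hcover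
  have hcontra : (D ∩ L ∩
      ({x : ℙ ℝ V | q x.rep ∈ Ioi 0} ∩ {x : ℙ ℝ V | q x.rep ∈ Iio 0})).Nonempty := by
    rcases mul_neg_iff.1 hαβ with ⟨h1, h2⟩ | ⟨h1, h2⟩
    · refine hsep ⟨_, hbmem, (hpos b hb0).2 ?_⟩ ⟨_, hamem, (hneg a ha0).2 ?_⟩
      · rw [mem_Ioi, hqb]; positivity
      · rw [mem_Iio, hqa]; exact mul_neg_of_pos_of_neg hs0 h2
    · refine hsep ⟨_, hamem, (hpos a ha0).2 ?_⟩ ⟨_, hbmem, (hneg b hb0).2 ?_⟩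
      · rw [mem_Ioi, hqa]; positivity
      · rw [mem_Iio, hqb]; exact mul_neg_of_pos_of_neg hr0 h1
  obtain ⟨x, -, hx1, hx2⟩ := hcontra
  exact lt_asymm (show 0 < q x.rep from hx1) hx2

/-- Two vectors over a convex set are joined by a segment over this set for exactly one choice of
their relative sign. -/
lemma segment_subset_coneOver_xor {D : Set (ℙ ℝ V)} (hconv : IsProjConvex D) {a b : V}
    (ha : a ∈ coneOver D) (hb : b ∈ coneOver D) :
    Xor (segment ℝ a b ⊆ coneOver D) (segment ℝ a (-b) ⊆ coneOver D) := by
  have h0 : (0 : V) ∉ coneOver D := fun h => h.1 rfl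
  have ha0 : a ≠ 0 := ha.1
  by_cases hab : LinearIndependent ℝ ![a, b]
  · have hnb : -b ∈ coneOver D := by simpa using smul_mem_coneOver (c := (-1 : ℝ)) (by simp) hb
    have hab' : LinearIndependent ℝ ![a, -b] := by
      rw [LinearIndependent.pair_iff] at hab ⊢
      intro s t h
      have := hab s (-t) (by simpa using h)
      simpa using this
    have hLline : IsProjLine ((Submodule.span ℝ {a, b}).projectivization : Set (ℙ ℝ V)) :=
      isProjLine_span_pair hab
    -- The sign of `α * β` at a missing point tells whether a multiple of it lies on `[a, b]` or on
    -- `[a, -b]`.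
    obtain ⟨p, hpL, hpD⟩ := not_subset.1 (hconv _ hLline).1
    induction p using Projectivization.ind with | _ v hv =>
    have hvM := (Submodule.mk_mem_projectivization_iff _ hv).1 hpL
    obtain ⟨α, β, rfl⟩ := Submodule.mem_span_pair.1 hvM
    have hu : α • a + β • b ∉ coneOver D := fun ⟨_, h⟩ => hpD h
    have hα : α ≠ 0 := by
      rintro rfl
      refine hu ?_
      rw [zero_smul, zero_add] at hv ⊢
      exact smul_mem_coneOver (left_ne_zero_of_smul hv) hb
    have hβ : β ≠ 0 := by
      rintro rfl
      refine hu ?_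
      rw [zero_smul, add_zero] at hv ⊢
      exact smul_mem_coneOver (left_ne_zero_of_smul hv) ha
    have hscale : ∀ c : ℝ, c ≠ 0 → c • (α • a + β • b) ∉ coneOver D := fun c hc h => by
      have := smul_mem_coneOver (inv_ne_zero hc) h
      rw [inv_smul_smul₀ hc] at this
      exact hu this
    rcases lt_or_gt_of_ne (mul_ne_zero hα hβ) with h | h
    · refine Or.inl ⟨segment_subset_coneOver hconv ha hb hab h hu, fun hs => ?_⟩
      have hd : α - β ≠ 0 := fun h' => by
        rw [sub_eq_zero.1 h'] at h; nlinarith [mul_self_nonneg β]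
      refine hscale (α - β)⁻¹ (inv_ne_zero hd) (hs ⟨α / (α - β), -β / (α - β), ?_, ?_, ?_, ?_⟩)
      · have : 0 ≤ α * (α - β) := by nlinarith [mul_self_nonneg α]
        rw [← mul_div_mul_right _ _ hd]; exact div_nonneg this (mul_self_nonneg _)
      · have : 0 ≤ -β * (α - β) := by nlinarith [mul_self_nonneg β]
        rw [← mul_div_mul_right _ _ hd]; exact div_nonneg this (mul_self_nonneg _)
      · field_simp; ring
      · rw [smul_add, smul_smul, smul_smul, smul_neg, ← neg_smul]
        congr 2 <;> field_simp
    · refine Or.inr ⟨segment_subset_coneOver (α := α) (β := -β) hconv ha hnb hab'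
        (by linarith) (by simpa using hu), fun hs => ?_⟩
      have hd : α + β ≠ 0 := fun h' => by
        rw [eq_neg_of_add_eq_zero_left h'] at h; nlinarith [mul_self_nonneg β]
      refine hscale (α + β)⁻¹ (inv_ne_zero hd) (hs ⟨α / (α + β), β / (α + β), ?_, ?_, ?_, ?_⟩)
      · have : 0 ≤ α * (α + β) := by nlinarith [mul_self_nonneg α]
        rw [← mul_div_mul_right _ _ hd]; exact div_nonneg this (mul_self_nonneg _)
      · have : 0 ≤ β * (α + β) := by nlinarith [mul_self_nonneg β]
        rw [← mul_div_mul_right _ _ hd]; exact div_nonneg this (mul_self_nonneg _)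
      · field_simp
      · rw [smul_add, smul_smul, smul_smul]
        congr 2 <;> field_simp
  -- For `b = t • a` only the vector `0` can obstruct, and it lies on `[a, b]` exactly when `t < 0`.
  · rw [LinearIndependent.pair_iff' ha0] at hab
    push Not at hab
    obtain ⟨t, rfl⟩ := hab
    have ht : t ≠ 0 := left_ne_zero_of_smul hb.1
    have hyes : ∀ t : ℝ, 0 < t → segment ℝ a (t • a) ⊆ coneOver D := by
      rintro t ht _ ⟨r, s, hr, hs, hrs, rfl⟩
      rw [smul_smul, ← add_smul]
      refine smul_mem_coneOver ?_ ha
      rcases hr.eq_or_lt with rfl | hr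
      · have : s = 1 := by linarith
        subst this; positivity
      · positivity
    have hno : ∀ t : ℝ, t < 0 → ¬ segment ℝ a (t • a) ⊆ coneOver D := by
      intro t ht h
      have hd : (1 : ℝ) - t > 0 := by linarith
      refine h0 (h ⟨-t / (1 - t), 1 / (1 - t),
        div_nonneg (by linarith) hd.le, by positivity, ?_, ?_⟩)
      · field_simp; ring
      · rw [smul_smul, ← add_smul]
        convert zero_smul ℝ a using 2
        field_simp; ring
    rw [← neg_smul]
    rcases lt_or_gt_of_ne ht with ht | ht
    · exact Or.inr ⟨hyes _ (by linarith), hno _ ht⟩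
    · exact Or.inl ⟨hyes _ ht, hno _ (by linarith)⟩

/-- An open convex set in a real projective space is covered by an open convex cone, which is unique
up to sign. -/
theorem exists_convex_cone {D : Set (ℙ ℝ V)} (hopen : IsOpen D) (hconv : IsProjConvex D)
    (hne : D.Nonempty) :
    ∃ C : Set V, IsOpen C ∧ Convex ℝ C ∧ (0 : V) ∉ C ∧
      (∀ t : ℝ, 0 < t → ∀ v ∈ C, t • v ∈ C) ∧ (∀ v, v ∈ coneOver D ↔ v ∈ C ∨ -v ∈ C) ∧
      ∀ a b, segment ℝ a b ⊆ coneOver D → (a ∈ C ↔ b ∈ C) := by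
  set W := coneOver D with hWdef
  have hW : IsOpen W := isOpen_coneOver hopen
  have hnW : ∀ v ∈ W, -v ∈ W := fun v hv => by
    simpa using smul_mem_coneOver (c := (-1 : ℝ)) (by simp) hv
  -- The conditions `[c, x] ⊆ W` and `[c, -x] ⊆ W` are open in `x`, and exactly one holds at each
  -- point of the connected `[a, b]`; hence the same one holds throughout.
  have htrans : ∀ a b c, c ∈ W → segment ℝ a b ⊆ W →
      (segment ℝ c a ⊆ W ↔ segment ℝ c b ⊆ W) := by
    have himp : ∀ a b c, c ∈ W → segment ℝ a b ⊆ W → segment ℝ c a ⊆ W → segment ℝ c b ⊆ W := by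
      intro a b c hc hab hca
      by_contra hcb
      have hpre : IsPreconnected (segment ℝ a b) := (convex_segment a b).isPreconnected
      have ho2 : IsOpen {x | segment ℝ c (-x) ⊆ W} :=
        (isOpen_setOf_segment_subset hW c).preimage continuous_neg
      have hb : b ∈ segment ℝ a b := right_mem_segment ..
      obtain ⟨x, hx, hx1, hx2⟩ := hpre _ _ (isOpen_setOf_segment_subset hW c) ho2
        (fun x hx => (segment_subset_coneOver_xor hconv hc (hab hx)).or)
        ⟨a, left_mem_segment .., hca⟩
        ⟨b, hb, ((segment_subset_coneOver_xor hconv hc (hab hb)).or.resolve_left hcb)⟩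
      rcases segment_subset_coneOver_xor hconv hc (hab hx) with h | h
      · exact h.2 hx2
      · exact h.2 hx1
    exact fun a b c hc hab => ⟨himp a b c hc hab, himp b a c hc (by rwa [segment_symm])⟩
  obtain ⟨v₀, hv₀⟩ : W.Nonempty := by
    obtain ⟨x, hx⟩ := hne
    induction x using Projectivization.ind with | _ v hv => exact ⟨v, hv, hx⟩
  have hCW : ∀ v, segment ℝ v₀ v ⊆ W → v ∈ W := fun v hv => hv (right_mem_segment ..)
  refine ⟨{v | segment ℝ v₀ v ⊆ W}, isOpen_setOf_segment_subset hW v₀, ?_, ?_, ?_, ?_, ?_⟩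
  · rw [convex_iff_segment_subset]
    intro v hv w hw p hp
    have hvw : segment ℝ v w ⊆ W :=
      (htrans _ _ v (hCW v hv) hw).1 (by rwa [segment_symm])
    exact (htrans v p v₀ hv₀ (((convex_segment v w).segment_subset (left_mem_segment ..) hp).trans
      hvw)).1 hv
  · exact fun h => (hCW 0 h).1 rfl
  · intro t ht v hv
    refine (htrans v (t • v) v₀ hv₀ ?_).1 hv
    rintro _ ⟨r, s, hr, hs, hrs, rfl⟩
    rw [smul_smul, ← add_smul]
    refine smul_mem_coneOver ?_ (hCW v hv)
    rcases hr.eq_or_lt with rfl | hr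
    · have : s = 1 := by linarith
      subst this; positivity
    · positivity
  · refine fun v => ⟨fun hv => (segment_subset_coneOver_xor hconv hv₀ hv).or, ?_⟩
    rintro (h | h)
    · exact hCW v h
    · simpa using hnW _ (hCW _ h)
  · exact fun a b hab => htrans a b v₀ hv₀ hab

end RealCone

/-! ### Retracts, the quotient map and normalized representatives. -/

/-- A space through whose identity a contractible space factors is contractible. -/
lemma contractibleSpace_of_rightInverse {X Y : Type*} [TopologicalSpace X] [TopologicalSpace Y]
    [ContractibleSpace X] (f : C(X, Y)) (s : C(Y, X)) (h : ∀ y, f (s y) = y) :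
    ContractibleSpace Y := by
  rw [contractible_iff_id_nullhomotopic]
  have := ((id_nullhomotopic X).comp_right f).comp_left s
  rwa [show (f.comp (ContinuousMap.id X)).comp s = ContinuousMap.id Y from
    ContinuousMap.ext h] at this

section Quotient

variable {K V : Type*} [Field K] [AddCommGroup V] [Module K V] [TopologicalSpace V]
  [ContinuousConstSMul K V]

/-- The saturation of an open set is a union of its preimages under scalings. Openness lets
continuity at a projective point be tested on vectors. -/
lemma isOpenQuotientMap_mk' :
    IsOpenQuotientMap (Projectivization.mk' K : {v : V // v ≠ 0} → ℙ K V) where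
  surjective := Quotient.mk_surjective
  continuous := continuous_quotient_mk'
  isOpenMap := by
    intro U hU
    change IsOpen (Projectivization.mk' K ⁻¹' (Projectivization.mk' K '' U))
    have : (Projectivization.mk' K ⁻¹' (Projectivization.mk' K '' U) : Set {v : V // v ≠ 0}) =
        ⋃ c : Kˣ, (fun v : {v : V // v ≠ 0} =>
          (⟨c • (v : V), (smul_ne_zero_iff_ne c).2 v.2⟩ : {v : V // v ≠ 0})) ⁻¹' U := by
      ext v
      simp only [mem_preimage, mem_image, mem_iUnion]
      constructor
      · rintro ⟨w, hw, h⟩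
        rw [Projectivization.mk'_eq_mk, Projectivization.mk'_eq_mk,
          Projectivization.mk_eq_mk_iff] at h
        obtain ⟨c, hc⟩ := h
        exact ⟨c, by simpa [hc] using hw⟩
      · rintro ⟨c, hc⟩
        refine ⟨_, hc, ?_⟩
        rw [Projectivization.mk'_eq_mk, Projectivization.mk'_eq_mk, Projectivization.mk_eq_mk_iff]
        exact ⟨c, rfl⟩
    rw [this]
    refine isOpen_iUnion fun c => hU.preimage ?_
    exact (continuous_subtype_val.const_smul (c : K)).subtype_mk _

end Quotient

section NormalizedRep

variable {K V : Type*} [Field K] [AddCommGroup V] [Module K V]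

/-- The representative of a point of projective space on which `ξ` takes the value `1`. -/
noncomputable def normalizedRep (ξ : V →ₗ[K] K) (p : ℙ K V) : V := (ξ p.rep)⁻¹ • p.rep

lemma normalizedRep_mk (ξ : V →ₗ[K] K) (v : V) (hv : v ≠ 0) :
    normalizedRep ξ (Projectivization.mk K v hv) = (ξ v)⁻¹ • v := by
  obtain ⟨c, hc⟩ := Projectivization.exists_smul_eq_mk_rep K v hv
  rw [normalizedRep, ← hc, Units.smul_def, map_smul, smul_smul, smul_eq_mul, mul_inv, mul_assoc,
    mul_left_comm, inv_mul_cancel₀ c.ne_zero, mul_one]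

end NormalizedRep

/-! ### The complexified cone and its slices by lines. -/

section Complex

variable {n : ℕ}

/-- The complex vectors whose real and imaginary parts lie in `C`. -/
def complexCone (C : Set (Fin (n + 1) → ℝ)) : Set (Fin (n + 1) → ℂ) :=
  {z | (fun i => (z i).re) ∈ C ∧ (fun i => (z i).im) ∈ C}

lemma isOpen_complexCone {C : Set (Fin (n + 1) → ℝ)} (hC : IsOpen C) :
    IsOpen (complexCone C) :=
  (hC.preimage (f := fun (z : Fin (n + 1) → ℂ) i => (z i).re) (by fun_prop)).inter
    (hC.preimage (f := fun (z : Fin (n + 1) → ℂ) i => (z i).im) (by fun_prop))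

lemma convex_complexCone {C : Set (Fin (n + 1) → ℝ)} (hC : Convex ℝ C) :
    Convex ℝ (complexCone C) := by
  intro z hz w hw a b ha hb hab
  constructor
  · convert hC hz.1 hw.1 ha hb hab using 1
    ext i; simp
  · convert hC hz.2 hw.2 ha hb hab using 1
    ext i; simp

lemma complexCone_ne_zero {C : Set (Fin (n + 1) → ℝ)} (hC : 0 ∉ C) {z : Fin (n + 1) → ℂ}
    (hz : z ∈ complexCone C) : z ≠ 0 := by
  rintro rfl
  exact hC hz.1

/-- The complex linear extension of a real linear functional. -/
noncomputable def complexDual (f : (Fin (n + 1) → ℝ) →ₗ[ℝ] ℝ) : (Fin (n + 1) → ℂ) →ₗ[ℂ] ℂ :=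
  ∑ i, (f (fun j => if i = j then 1 else 0) : ℂ) • LinearMap.proj i

/-- If `f < 0` on `C`, this makes `complexDual f` nonvanishing on `complexCone C`. -/
lemma complexDual_re (f : (Fin (n + 1) → ℝ) →ₗ[ℝ] ℝ) (z : Fin (n + 1) → ℂ) :
    (complexDual f z).re = f (fun i => (z i).re) := by
  rw [LinearMap.pi_apply_eq_sum_univ f]
  simp [complexDual, mul_comm]

/-- The set of classes of the vectors in `complexCone C` is `ℂ`-convex if `C` is convex and open and
does not contain `0`. Its nonempty intersections with projective lines are retracts of convex
sets. -/
lemma isCConvex_of_complexCone {C : Set (Fin (n + 1) → ℝ)} (hopen : IsOpen C) (hconv : Convex ℝ C)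
    (hC0 : 0 ∉ C) {E : Set (ℙ ℂ (Fin (n + 1) → ℂ))}
    (hE : ∀ p, p ∈ E ↔ ∃ z, ∃ h : z ≠ 0, z ∈ complexCone C ∧ p = Projectivization.mk ℂ z h) :
    IsCConvex E := by
  obtain ⟨f, hf⟩ : ∃ f : (Fin (n + 1) → ℝ) →ₗ[ℝ] ℝ, ∀ x ∈ C, f x < 0 := by
    obtain ⟨f, hf⟩ := geometric_hahn_banach_open_point hconv hopen hC0
    exact ⟨f.toLinearMap, fun x hx => by simpa using hf x hx⟩
  set ξ := complexDual f with hξ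
  have hξne : ∀ z ∈ complexCone C, ξ z ≠ 0 := fun z hz h => by
    have h1 := complexDual_re f z
    rw [← hξ, h] at h1
    exact (hf _ hz.1).ne h1.symm
  rintro L ⟨M, hM, rfl⟩
  refine ⟨fun hsub => ?_, fun hne => ?_⟩
  · have hlt : Module.finrank ℂ ℂ < Module.finrank ℂ M := by rw [hM]; simp
    obtain ⟨v, hv, hv0⟩ := Submodule.exists_mem_ne_zero_of_ne_bot
      (LinearMap.ker_ne_bot_of_finrank_lt (f := ξ ∘ₗ M.subtype) hlt)
    have hv0' : (v : Fin (n + 1) → ℂ) ≠ 0 := by simpa using hv0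
    obtain ⟨z, hz0, hz, hvz⟩ := (hE _).1 (hsub
      ((Submodule.mk_mem_projectivization_iff M hv0').2 v.2))
    obtain ⟨c, hc⟩ := (Projectivization.mk_eq_mk_iff' ℂ _ _ _ _).1 hvz
    refine hξne z hz ?_
    have h1 : ξ v = 0 := hv
    rw [← hc, map_smul, smul_eq_mul, mul_eq_zero] at h1
    refine h1.resolve_left ?_
    rintro rfl
    exact hv0' (by simpa using hc.symm)
  · suffices hcontr : ContractibleSpace
        ↥(E ∩ (M.projectivization : Set (ℙ ℂ (Fin (n + 1) → ℂ)))) by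
      have hsc : IsSimplyConnected (E ∩ (M.projectivization : Set (ℙ ℂ (Fin (n + 1) → ℂ)))) :=
        SimplyConnectedSpace.ofContractible _
      exact ⟨hsc.isPathConnected.isConnected, hsc⟩
    set Q : Set (Fin (n + 1) → ℂ) := complexCone C ∩ M with hQ
    have hQ0 : ∀ z ∈ Q, z ≠ 0 := fun z hz => complexCone_ne_zero hC0 hz.1
    set EL := E ∩ (M.projectivization : Set (ℙ ℂ (Fin (n + 1) → ℂ))) with hEL
    have hmem : ∀ p ∈ EL, ∃ z, ∃ h : z ≠ 0, z ∈ Q ∧ p = Projectivization.mk ℂ z h := by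
      rintro p ⟨hp, hpM⟩
      obtain ⟨z, hz0, hz, rfl⟩ := (hE p).1 hp
      exact ⟨z, hz0, ⟨hz, (Submodule.mk_mem_projectivization_iff M hz0).1 hpM⟩, rfl⟩
    have hmk : ∀ z (hz : z ∈ Q), Projectivization.mk ℂ z (hQ0 z hz) ∈ EL := fun z hz =>
      ⟨(hE _).2 ⟨z, hQ0 z hz, hz.1, rfl⟩, (Submodule.mk_mem_projectivization_iff M _).2 hz.2⟩
    have hQconv : Convex ℝ Q :=
      (convex_complexCone hconv).inter (M.restrictScalars ℝ).convex
    have hQne : Q.Nonempty := by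
      obtain ⟨p, hp⟩ := hne
      obtain ⟨z, _, hz, -⟩ := hmem p hp
      exact ⟨z, hz⟩
    have : ContractibleSpace Q := hQconv.contractibleSpace hQne
    let π : C(Q, EL) := ⟨fun z => ⟨Projectivization.mk ℂ z.1 (hQ0 z.1 z.2), hmk z.1 z.2⟩, by
      refine Continuous.subtype_mk ?_ _
      exact (isOpenQuotientMap_mk' (K := ℂ)).continuous.comp
        (continuous_subtype_val.subtype_mk fun z => hQ0 z.1 z.2)⟩
    set S : Set (Fin (n + 1) → ℂ) := {z | z ∈ M ∧ z ≠ 0 ∧ ∃ c : ℂ, c • z ∈ complexCone C} with hS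
    -- The admissible scalars form a convex set, and by openness of the cone a scalar valid at `z`
    -- stays valid nearby.
    obtain ⟨c, hc⟩ : ∃ c : C(S, ℂ), ∀ z : S,
        c z ∈ {c : ℂ | c • (z : Fin (n + 1) → ℂ) ∈ complexCone C} := by
      refine exists_continuous_forall_mem_convex_of_local_const (fun z => ?_) fun z => ?_
      · exact (convex_complexCone hconv).linear_preimage
          ((LinearMap.toSpanSingleton ℂ _ (z : Fin (n + 1) → ℂ)).restrictScalars ℝ)
      · obtain ⟨c, hc⟩ := z.2.2.2
        refine ⟨c, ?_⟩
        exact ((continuous_subtype_val.const_smul c).continuousAt.preimage_mem_nhds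
          ((isOpen_complexCone hopen).mem_nhds hc))
    let g : C(S, Q) := ⟨fun z => ⟨c z • z.1, hc z, M.smul_mem _ z.2.1⟩, by
      refine Continuous.subtype_mk ?_ _
      exact c.continuous.smul continuous_subtype_val⟩
    have hnorm : ∀ p ∈ EL, normalizedRep ξ p ∈ S := by
      intro p hp
      obtain ⟨z, hz0, hz, rfl⟩ := hmem p hp
      have h1 := hξne z hz.1
      rw [normalizedRep_mk]
      refine ⟨M.smul_mem _ hz.2, smul_ne_zero (inv_ne_zero h1) hz0, ξ z, ?_⟩
      rw [smul_inv_smul₀ h1]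
      exact hz.1
    let r : C(EL, S) := ⟨fun p => ⟨normalizedRep ξ p, hnorm p p.2⟩, by
      refine Continuous.subtype_mk ?_ _
      rw [continuous_iff_continuousAt]
      rintro ⟨p, hp⟩
      change ContinuousAt (normalizedRep ξ ∘ Subtype.val) _
      refine ContinuousAt.comp ?_ continuous_subtype_val.continuousAt
      obtain ⟨z, hz0, hz, rfl⟩ := hmem p hp
      have h1 := hξne z hz.1
      refine (isOpenQuotientMap_mk' (K := ℂ)).continuousAt_comp_iff (x := ⟨z, hz0⟩) |>.1 ?_
      have hξc : Continuous ξ := ξ.continuous_of_finiteDimensional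
      have : normalizedRep ξ ∘ Projectivization.mk' ℂ =
          fun v : {v : Fin (n + 1) → ℂ // v ≠ 0} => (ξ v)⁻¹ • (v : Fin (n + 1) → ℂ) :=
        funext fun v => normalizedRep_mk ξ v.1 v.2
      rw [this]
      exact (ContinuousAt.inv₀ (a := (⟨z, hz0⟩ : {v : Fin (n + 1) → ℂ // v ≠ 0}))
        (hξc.comp continuous_subtype_val).continuousAt h1).smul
        continuous_subtype_val.continuousAt⟩
    refine contractibleSpace_of_rightInverse π (g.comp r) ?_
    rintro ⟨p, hp⟩
    obtain ⟨z, hz0, hz, rfl⟩ := hmem p hp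
    refine Subtype.ext ?_
    refine (Projectivization.mk_eq_mk_iff' ℂ _ _ _ _).2 ⟨c (r ⟨_, hp⟩) * (ξ z)⁻¹, ?_⟩
    rw [mul_smul, ← normalizedRep_mk ξ z hz0]
    rfl

/-! ### The tube as the image of the complexified cone. -/

/-- The elliptic tube over an open convex set consists of the classes of the vectors `x + i y`
with `x`, `y` in the convex cone over this set. -/
lemma mem_ellipticTube_iff {D : Set (ℙ ℝ (Fin (n + 1) → ℝ))} {C : Set (Fin (n + 1) → ℝ)}
    (hconv : Convex ℝ C) (hC0 : 0 ∉ C) (hsmul : ∀ t : ℝ, 0 < t → ∀ v ∈ C, t • v ∈ C)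
    (hCD : ∀ v, v ∈ coneOver D ↔ v ∈ C ∨ -v ∈ C)
    (hseg : ∀ a b, segment ℝ a b ⊆ coneOver D → (a ∈ C ↔ b ∈ C))
    (p : ℙ ℂ (Fin (n + 1) → ℂ)) :
    p ∈ ellipticTube D ↔
      ∃ z, ∃ h : z ≠ 0, z ∈ complexCone C ∧ p = Projectivization.mk ℂ z h := by
  have hadd : ∀ s t : ℝ, 0 ≤ s → 0 ≤ t → 0 < s + t → ∀ v ∈ C, ∀ w ∈ C, s • v + t • w ∈ C := by
    intro s t hs ht hst v hv w hw
    rcases hs.eq_or_lt with rfl | hs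
    · simpa using hsmul t (by linarith) w hw
    rcases ht.eq_or_lt with rfl | ht
    · simpa using hsmul s hs v hv
    have := hsmul (s + t) hst _ (hconv hv hw (a := s / (s + t)) (b := t / (s + t))
      (by positivity) (by positivity) (by field_simp))
    rw [smul_add, smul_smul, smul_smul, mul_div_cancel₀ _ hst.ne',
      mul_div_cancel₀ _ hst.ne'] at this
    exact this
  constructor
  -- The factor `m` rotates both coefficients into the closed first quadrant, with real parts not
  -- both zero and imaginary parts not both zero. After division by `c₀` they are `1` and `w` with
  -- `Re w ≥ 0`, and the sign of `Im w` selects the rotation.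
  · have main : ∀ v₀ ∈ C, ∀ v₁ ∈ C, ∀ c₀ c₁ : ℂ, (c₀ ≠ 0 ∨ c₁ ≠ 0) →
        0 ≤ (c₀ * (starRingEnd ℂ) c₁).re →
        ∃ m : ℂ, m ≠ 0 ∧ m • (c₀ • complexify v₀ + c₁ • complexify v₁) ∈ complexCone C := by
      intro v₀ h₀ v₁ h₁ c₀ c₁ hne hre
      have hm : ∀ a b : ℂ, 0 ≤ a.re → 0 ≤ a.im → 0 ≤ b.re → 0 ≤ b.im → 0 < a.re + b.re →
          0 < a.im + b.im → a • complexify v₀ + b • complexify v₁ ∈ complexCone C := by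
        intro a b h1 h2 h3 h4 h5 h6
        constructor
        · convert hadd _ _ h1 h3 h5 v₀ h₀ v₁ h₁ using 1
          ext i; simp [complexify]
        · convert hadd _ _ h2 h4 h6 v₀ h₀ v₁ h₁ using 1
          ext i; simp [complexify]
      have hm' : ∀ m : ℂ, m • (c₀ • complexify v₀ + c₁ • complexify v₁) =
          (m * c₀) • complexify v₀ + (m * c₁) • complexify v₁ := fun m => by
        rw [smul_add, smul_smul, smul_smul]
      by_cases h0 : c₀ = 0
      · have hc1 : c₁ ≠ 0 := hne.resolve_left (not_not.2 h0)
        refine ⟨(1 + Complex.I) / c₁, div_ne_zero ?_ hc1, ?_⟩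
        · intro h; simpa using congrArg Complex.re h
        · rw [hm', div_mul_cancel₀ _ hc1, h0]
          apply hm <;> simp
      · obtain ⟨w, rfl⟩ : ∃ w, c₁ = c₀ * w := ⟨c₁ / c₀, by field_simp⟩
        have hw : 0 ≤ w.re := by
          have h1 : (c₀ * (starRingEnd ℂ) (c₀ * w)).re = Complex.normSq c₀ * w.re := by
            simp [Complex.normSq_apply]; ring
          rw [h1] at hre
          exact nonneg_of_mul_nonneg_right hre (Complex.normSq_pos.2 h0)
        have hmm : ∀ k : ℂ, k / c₀ * (c₀ * w) = k * w := fun k => by field_simp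
        rcases lt_trichotomy w.im 0 with hi | hi | hi
        · refine ⟨Complex.I / c₀, div_ne_zero Complex.I_ne_zero h0, ?_⟩
          rw [hm', div_mul_cancel₀ _ h0, hmm]
          apply hm <;> simp <;> linarith
        · refine ⟨(1 + Complex.I) / c₀, div_ne_zero ?_ h0, ?_⟩
          · intro h; simpa using congrArg Complex.re h
          · rw [hm', div_mul_cancel₀ _ h0, hmm]
            apply hm <;> simp <;> linarith
        · refine ⟨1 / c₀, div_ne_zero one_ne_zero h0, ?_⟩
          rw [hm', div_mul_cancel₀ _ h0, hmm]
          apply hm <;> simp <;> linarith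
    rintro ⟨v₀, v₁, hv₀, hv₁, hsub, c₀, c₁, hne, hre, rfl⟩
    suffices hz : ∃ m : ℂ, m ≠ 0 ∧ m • (c₀ • complexify v₀ + c₁ • complexify v₁) ∈ complexCone C by
      obtain ⟨m, hm, hmC⟩ := hz
      refine ⟨_, smul_ne_zero hm hne, hmC, ?_⟩
      exact (Projectivization.mk_eq_mk_iff' ℂ _ _ _ _).2 ⟨m⁻¹, inv_smul_smul₀ hm _⟩
    have hc : c₀ ≠ 0 ∨ c₁ ≠ 0 := by
      by_contra! h
      exact hne (by simp [h.1, h.2])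
    have hmemD : ∀ s t : ℝ, 0 ≤ s * t → s • v₀ + t • v₁ ≠ 0 → s • v₀ + t • v₁ ∈ coneOver D :=
      fun s t hst h => ⟨h, hsub ⟨s, t, h, hst, rfl⟩⟩
    have hneg : ∀ v, complexify (-v) = -complexify (n := n) v := fun v => by
      ext i; simp [complexify]
    have h0D : v₀ ∈ coneOver D := by simpa using hmemD 1 0 (by simp) (by simpa using hv₀)
    by_cases hs : segment ℝ v₀ v₁ ⊆ coneOver D
    · rcases (hCD v₀).1 h0D with h | h
      · exact main v₀ h v₁ ((hseg _ _ hs).1 h) c₀ c₁ hc hre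
      · have h1 : v₁ ∉ C := fun h1 => hC0 (by
          simpa using hadd 1 1 zero_le_one zero_le_one (by norm_num) _ ((hseg _ _ hs).2 h1) _ h)
        have h1' := ((hCD v₁).1 (hs (right_mem_segment ..))).resolve_left h1
        obtain ⟨m, hm, hmC⟩ := main _ h _ h1' c₀ c₁ hc hre
        refine ⟨-m, neg_ne_zero.2 hm, ?_⟩
        convert hmC using 1
        simp only [hneg]; module
    -- The vector segment can leave the cone only through `0`; then `v₁` is a negative multiple of
    -- `v₀` and the disc is a single point.
    · obtain ⟨q, ⟨s, t, hs, ht, hst, rfl⟩, hq⟩ := not_subset.1 hs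
      have hz : s • v₀ + t • v₁ = 0 := by
        by_contra h
        exact hq (hmemD s t (mul_nonneg hs ht) h)
      have ht0 : t ≠ 0 := by
        rintro rfl
        have : s = 1 := by linarith
        subst this
        exact hv₀ (by simpa using hz)
      have hv1 : v₁ = (-(s / t)) • v₀ := by
        have : t • v₁ = (-s) • v₀ := by rw [neg_smul]; exact eq_neg_of_add_eq_zero_right hz
        rw [← inv_smul_smul₀ ht0 v₁, this, smul_smul]
        congr 1; field_simp
      have hz' : c₀ • complexify v₀ + c₁ • complexify v₁ =
          (c₀ + c₁ * (-(s / t) : ℝ)) • complexify v₀ := by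
        rw [add_smul, mul_smul]
        congr 2
        rw [hv1]; ext i; simp [complexify]
      have hk : c₀ + c₁ * (-(s / t) : ℝ) ≠ 0 := fun h => hne (by rw [hz', h, zero_smul])
      rcases (hCD v₀).1 h0D with h | h
      · obtain ⟨m, hm, hmC⟩ := main v₀ h v₀ h _ 0 (Or.inl hk) (by simp)
        exact ⟨m, hm, by rw [hz']; simpa using hmC⟩
      · obtain ⟨m, hm, hmC⟩ := main _ h _ h (c₀ + c₁ * (-(s / t) : ℝ)) 0 (Or.inl hk) (by simp)
        refine ⟨-m, neg_ne_zero.2 hm, ?_⟩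
        rw [hz']
        convert hmC using 1
        simp only [hneg]; module
  · rintro ⟨z, hz0, ⟨hx, hy⟩, rfl⟩
    have hne : ∀ v ∈ C, v ≠ 0 := fun v hv h => hC0 (h ▸ hv)
    have hz : z = (1 : ℂ) • complexify (fun i => (z i).re) +
        Complex.I • complexify (fun i => (z i).im) := by
      ext i
      simp [complexify, mul_comm Complex.I]
    -- The coefficients `1` and `i` satisfy `Re (c₀ c̄₁) = 0`, the extreme case allowed in the disc.
    refine ⟨fun i => (z i).re, fun i => (z i).im, hne _ hx, hne _ hy, ?_, 1, Complex.I, hz ▸ hz0,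
      by simp, ?_⟩
    · rintro _ ⟨s, t, h, hst, rfl⟩
      suffices hmem : s • (fun i => (z i).re) + t • (fun i => (z i).im) ∈ coneOver D from hmem.2
      rw [hCD]
      have hst0 : s ≠ 0 ∨ t ≠ 0 := by
        by_contra! h'
        exact h (by simp [h'.1, h'.2])
      rcases mul_nonneg_iff.1 hst with ⟨hs, ht⟩ | ⟨hs, ht⟩
      · refine Or.inl (hadd s t hs ht ?_ _ hx _ hy)
        rcases hst0 with h' | h' <;> positivity
      · right
        rw [neg_add, ← neg_smul, ← neg_smul]
        refine hadd _ _ (neg_nonneg.2 hs) (neg_nonneg.2 ht) ?_ _ hx _ hy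
        rcases hst0 with h' | h'
        · have := lt_of_le_of_ne hs h'; linarith
        · have := lt_of_le_of_ne ht h'; linarith
    · congr 1

end Complex

end EllipticTube

theorem mainTheorem7 (n : ℕ) (D : Set (ℙ ℝ (Fin (n + 1) → ℝ)))
    (hD_open : IsOpen D) (hD_conv : EllipticTube.IsProperlyConvex D)
    (hD_bdry : EllipticTube.HasC1Boundary D) :
    EllipticTube.IsCConvex (EllipticTube.ellipticTube D) := by
  have hne : D.Nonempty := by
    by_contra h
    rw [Set.not_nonempty_iff_eq_empty] at h
    refine hD_conv.2.1 _ ⟨LinearMap.proj 0, fun h => ?_, rfl⟩ (h ▸ Set.empty_subset _)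
    simpa using LinearMap.congr_fun h (1 : Fin (n + 1) → ℝ)
  obtain ⟨C, hopen, hconv, hC0, hsmul, hCD, hseg⟩ :=
    EllipticTube.exists_convex_cone hD_open hD_conv.1 hne
  exact EllipticTube.isCConvex_of_complexCone hopen hconv hC0
    (EllipticTube.mem_ellipticTube_iff hconv hC0 hsmul hCD hseg)
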